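/- A graph is given by a vertex set $V$ and a set $E$ of directed edges, each $e\in E$ having an origin $o(e)$, a terminus $t(e)$ and an inverse $\overline e\ne e$ with $\overline{\overline e}=e$, $o(\overline e)=t(e)$ (loops and multiple edges are allowed). Let $E_x$ be the set of $e\in E$ with $o(e)=x$. Let $X_0=(V_0,E_0)$ be a finite connected graph and let $d\ge 1$. A $d$-dimensional topological crystal over $X_0$ is a connected graph $X=(V,E)$ together with a regular covering map $\omega:X\to X_0$ whose covering transformation group is free abelian of rank $d$. Its vanishing subgroup $H\subset H_1(X_0,\mathbb Z)$ is the kernel of the canonical homomorphism of $H_1(X_0,\mathbb Z)$ onto the covering transformation group; equivalently, $H=\omega_*H_1(X,\mathbb Z)$. Give $C_1(X_0,\mathbb R)$ (in which $\overline e=-e$) the inner product for which any orientation of $X_0$ is an orthonormal basis, let $P_0:C_1(X_0,\mathbb R)\to H_1(X_0,\mathbb R)$ be the orthogonal projection, let $H_{\mathbb R}$ be the real span of $H$, and let $P:H_1(X_0,\mathbb R)\to H_{\mathbb R}^{\perp}$ be the orthogonal projection to the orthogonal complement of $H_{\mathbb R}$ in $H_1(X_0,\mathbb R)$, which is $d$-dimensional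 and is identified with $\mathbb R^d$ by an orthonormal basis. A normalized standard realization of $X$ is a map $\Phi:V\to\mathbb R^d$ (extended affinely along edges) with $\Phi(t(e))-\Phi(o(e))=P(P_0(\omega(e)))$ for all $e\in E$; a standard realization is the composition of a normalized one with a similarity of $\mathbb R^d$ (so it is unique up to similarity). For a standard realization $\Phi$ put $\mathbf v(e)=\Phi(t(e))-\Phi(o(e))$. **Theorem.** Let $0<c\le 1$. For fixed $X_0$ and $d$ there are, up to isomorphism of covering graphs over $X_0$, only finitely many $d$-dimensional topological crystals $X$ over $X_0$ whose standard realization $\Phi$ satisfies (i) $\Phi$ is injective on the set of vertices (in particular, this holds if $\Phi$ is injective on the whole of $X$); (ii) for all vertices $x,y$ of $X$, if $\|\Phi(x)-\Phi(y)\|\le c\,\max_{e\in E_x}\|\mathbf v(e)\|$, then $y$ is adjacent to $x$ or $y=x$. -/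

import Mathlib

open Function

universe u v w w'

/-- A graph in the sense of directed edges: every edge carries two directions, `E` is the set of all
directed edges, `o e` is the origin of `e`, and `bar e` is the inversed edge, which is never `e`
itself. Loops and multiple edges are allowed. -/
structure DirGraph (V : Type u) (E : Type v) where
  o : E → V
  bar : E → E
  bar_bar : ∀ e, bar (bar e) = e
  bar_ne : ∀ e, bar e ≠ e

namespace DirGraph

variable {V : Type u} {E : Type v} {V₀ : Type w} {E₀ : Type w'}

/-- The terminus of a directed edge. -/
def t (X : DirGraph V E) (e : E) : V := X.o (X.bar e)

/-- `x` and `y` are joined by an edge. -/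
def Adj (X : DirGraph V E) (x y : V) : Prop := ∃ e, X.o e = x ∧ X.t e = y

/-- Non-empty, and any two vertices are joined by a path. -/
def IsConnected (X : DirGraph V E) : Prop :=
  Nonempty V ∧ ∀ x y, Relation.ReflTransGen X.Adj x y

/-! ### Chains and homology -/

section Homology

variable (K : Type*) [CommRing K]

/-- The group `C₁(X, K)` of 1-chains, in which `bar e = -e`: the chain `∑ a(e) e`, summed over an
orientation, is the finitely supported function `a` on all directed edges with
`a (bar e) = - a e`. -/
def C₁ (X : DirGraph V E) : Submodule K (E →₀ K) where
  carrier := {a | ∀ e, a (X.bar e) = -a e}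
  add_mem' := by
    intro a b ha hb e
    simp only [Finsupp.add_apply, ha e, hb e]
    ring
  zero_mem' := by intro e; simp
  smul_mem' := by
    intro r a ha e
    simp only [Finsupp.smul_apply, ha e, smul_neg]

/-- The directed edge `e`, regarded as a 1-chain. -/
noncomputable def edgeChain (X : DirGraph V E) (e : E) : E →₀ K :=
  Finsupp.single e 1 - Finsupp.single (X.bar e) 1

/-- The boundary operator: `∑ a(e) t(e)` over all directed edges, which for an element `a` of `C₁`
is `∑ a(e) (t(e) - o(e))` over an orientation. In particular it maps the 1-chain `e` to
`t(e) - o(e)`. -/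
noncomputable def boundary (X : DirGraph V E) : (E →₀ K) →ₗ[K] (V →₀ K) :=
  Finsupp.lmapDomain K K X.t

theorem boundary_edgeChain (X : DirGraph V E) (e : E) :
    X.boundary K (X.edgeChain K e) = Finsupp.single (X.t e) 1 - Finsupp.single (X.o e) 1 := by
  rw [boundary, edgeChain, map_sub, Finsupp.lmapDomain_apply, Finsupp.lmapDomain_apply,
    Finsupp.mapDomain_single, Finsupp.mapDomain_single, t, t, X.bar_bar]

/-- The first homology group `H₁(X, K)`: the 1-chains with boundary zero. -/
noncomputable def H₁ (X : DirGraph V E) : Submodule K (E →₀ K) :=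
  X.C₁ K ⊓ LinearMap.ker (X.boundary K)

end Homology

/-! ### Coverings -/

/-- A covering map of graphs: a surjective morphism that is bijective on the edges issuing from
each vertex. -/
structure Covering (X : DirGraph V E) (X₀ : DirGraph V₀ E₀) where
  onV : V → V₀
  onE : E → E₀
  map_o : ∀ e, X₀.o (onE e) = onV (X.o e)
  map_bar : ∀ e, X₀.bar (onE e) = onE (X.bar e)
  surj : Surjective onV
  bij : ∀ x, Set.BijOn onE {e | X.o e = x} {e₀ | X₀.o e₀ = onV x}

/-- The covering transformation group: the automorphisms of `X` that commute with the covering map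
onto `X₀`. -/
def Covering.deck {X : DirGraph V E} {X₀ : DirGraph V₀ E₀} (ω : Covering X X₀) :
    Subgroup (Equiv.Perm V × Equiv.Perm E) where
  carrier := {g | (∀ e, X.o (g.2 e) = g.1 (X.o e)) ∧ (∀ e, X.bar (g.2 e) = g.2 (X.bar e)) ∧
    (∀ x, ω.onV (g.1 x) = ω.onV x) ∧ ∀ e, ω.onE (g.2 e) = ω.onE e}
  mul_mem' := by
    rintro g h ⟨g1, g2, g3, g4⟩ ⟨h1, h2, h3, h4⟩
    simp_all
  one_mem' := by simp
  inv_mem' := by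
    rintro g ⟨g1, g2, g3, g4⟩
    refine ⟨fun e => ?_, fun e => ?_, fun x => ?_, fun e => ?_⟩
    · apply g.1.injective
      simp [← g1]
    · apply g.2.injective
      simp [← g2]
    · simpa using (g3 (g.1⁻¹ x)).symm
    · simpa using (g4 (g.2⁻¹ e)).symm

end DirGraph

open DirGraph

/-- A `d`-dimensional topological crystal over `X₀`: a connected graph with a regular covering map
onto `X₀` whose covering transformation group is free abelian of rank `d`. -/
structure TopologicalCrystal {V₀ : Type u} {E₀ : Type v} (X₀ : DirGraph V₀ E₀) (d : ℕ) where
  V : Type w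
  E : Type w'
  graph : DirGraph V E
  connected : graph.IsConnected
  proj : Covering graph X₀
  regular : ∀ x y, proj.onV x = proj.onV y → ∃ g ∈ proj.deck, g.1 x = y
  free_abelian : Nonempty (proj.deck ≃* Multiplicative (Fin d → ℤ))

/-- Isomorphism of topological crystals over `X₀`, that is, of covering graphs of `X₀`. -/
def TopologicalCrystal.Iso {V₀ : Type u} {E₀ : Type v} {X₀ : DirGraph V₀ E₀} {d : ℕ}
    (X Y : TopologicalCrystal.{u, v, w, w'} X₀ d) : Prop :=
  ∃ (f : X.V ≃ Y.V) (g : X.E ≃ Y.E),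
    (∀ e, Y.graph.o (g e) = f (X.graph.o e)) ∧ (∀ e, Y.graph.bar (g e) = g (X.graph.bar e)) ∧
    (∀ x, Y.proj.onV (f x) = X.proj.onV x) ∧ ∀ e, Y.proj.onE (g e) = X.proj.onE e

/-- Isomorphism over `X₀` as an equivalence relation. -/
def TopologicalCrystal.isoSetoid {V₀ : Type u} {E₀ : Type v} (X₀ : DirGraph V₀ E₀) (d : ℕ) :
    Setoid (TopologicalCrystal.{u, v, w, w'} X₀ d) where
  r := TopologicalCrystal.Iso
  iseqv := by
    refine ⟨fun X => ⟨Equiv.refl _, Equiv.refl _, by simp⟩, ?_, ?_⟩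
    · rintro X Y ⟨f, g, h1, h2, h3, h4⟩
      refine ⟨f.symm, g.symm, fun e => ?_, fun e => ?_, fun x => ?_, fun e => ?_⟩
      · apply f.injective
        simp [← h1]
      · apply g.injective
        simp [← h2]
      · simpa using (h3 (f.symm x)).symm
      · simpa using (h4 (g.symm e)).symm
    · rintro X Y Z ⟨f, g, h1, h2, h3, h4⟩ ⟨f', g', h1', h2', h3', h4'⟩
      exact ⟨f.trans f', g.trans g', by simp_all⟩

/-! ### Standard realizations -/

namespace DirGraph

variable {V₀ : Type u} {E₀ : Type v} [Fintype E₀]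

/-- The Euclidean structure on `C₁(X₀, ℝ)` for which an orientation is an orthonormal basis, that is
`⟨a, b⟩ = (1/2) ∑ a(e) b(e)` over all directed edges: `C₁(X₀, ℝ)` is placed isometrically in a
Euclidean space by the factor `1 / √2`. -/
noncomputable def chainVec : (E₀ →₀ ℝ) →ₗ[ℝ] EuclideanSpace ℝ E₀ :=
  (Real.sqrt 2)⁻¹ • ((WithLp.linearEquiv 2 ℝ (E₀ → ℝ)).symm.toLinearMap ∘ₗ Finsupp.lcoeFun)

/-- `H₁(X₀, ℝ)` as a Euclidean subspace. -/
noncomputable def H₁Real (X₀ : DirGraph V₀ E₀) : Submodule ℝ (EuclideanSpace ℝ E₀) :=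
  (X₀.H₁ ℝ).map chainVec

/-- `v₀(e) = P₀(e)`, the orthogonal projection of the 1-chain `e` to `H₁(X₀, ℝ)`. -/
noncomputable def v₀ (X₀ : DirGraph V₀ E₀) (e : E₀) : EuclideanSpace ℝ E₀ :=
  X₀.H₁Real.starProjection (chainVec (X₀.edgeChain ℝ e))

end DirGraph

namespace TopologicalCrystal

section

variable {V₀ : Type u} {E₀ : Type v} {X₀ : DirGraph V₀ E₀} {d : ℕ}

/-- The vanishing subgroup `H ⊆ H₁(X₀, ℤ)`: the image of `H₁(X, ℤ)` under the covering map, which is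
the kernel of the canonical homomorphism of `H₁(X₀, ℤ)` onto the covering transformation group. -/
noncomputable def vanishing (X : TopologicalCrystal.{u, v, w, w'} X₀ d) :
    Submodule ℤ (E₀ →₀ ℤ) :=
  (X.graph.H₁ ℤ).map (Finsupp.lmapDomain ℤ ℤ X.proj.onE)

variable [Fintype E₀]

/-- The real span `H_ℝ` of the vanishing subgroup. -/
noncomputable def vanishingReal (X : TopologicalCrystal.{u, v, w, w'} X₀ d) :
    Submodule ℝ (EuclideanSpace ℝ E₀) :=
  Submodule.span ℝ
    {p | ∃ a ∈ X.vanishing, p = chainVec (a.mapRange (Int.cast : ℤ → ℝ) Int.cast_zero)}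

/-- The orthogonal complement of `H_ℝ` in `H₁(X₀, ℝ)`. -/
noncomputable def vanishingPerp (X : TopologicalCrystal.{u, v, w, w'} X₀ d) :
    Submodule ℝ (EuclideanSpace ℝ E₀) :=
  X₀.H₁Real ⊓ X.vanishingRealᗮ

/-- `Φ` (given by its values on vertices and understood to be affine along edges) is a normalized
standard realization: after the identification of the orthogonal complement of `H_ℝ` with `ℝᵈ` by an
orthonormal basis, its building cochain is `v(e) = P(v₀(e))`, where `P` is the orthogonal projection
to this complement. -/
def IsNormalizedStandard (X : TopologicalCrystal.{u, v, w, w'} X₀ d)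
    (Φ : X.V → EuclideanSpace ℝ (Fin d)) : Prop :=
  ∃ ι : X.vanishingPerp ≃ₗᵢ[ℝ] EuclideanSpace ℝ (Fin d), ∀ e : X.E,
    Φ (X.graph.t e) - Φ (X.graph.o e) =
      ι (X.vanishingPerp.orthogonalProjectionOnto (X₀.v₀ (X.proj.onE e)))

/-- `Φ` is a standard realization: a similar transformation of a normalized one. -/
def IsStandard (X : TopologicalCrystal.{u, v, w, w'} X₀ d)
    (Φ : X.V → EuclideanSpace ℝ (Fin d)) : Prop :=
  ∃ Ψ : X.V → EuclideanSpace ℝ (Fin d), X.IsNormalizedStandard Ψ ∧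
    ∃ S : EuclideanSpace ℝ (Fin d) ≃ᵈ EuclideanSpace ℝ (Fin d), ∀ x, Φ x = S (Ψ x)

end

/-- The maximum of `‖v(e)‖ = ‖Φ(t(e)) - Φ(o(e))‖` over the (finitely many) edges `e` with origin
`x`. -/
noncomputable def maxEdge {V₀ : Type u} {E₀ : Type v} {X₀ : DirGraph V₀ E₀} {d : ℕ}
    (X : TopologicalCrystal.{u, v, w, w'} X₀ d) (Φ : X.V → EuclideanSpace ℝ (Fin d)) (x : X.V) :
    ℝ :=
  ⨆ e : {e : X.E // X.graph.o e = x}, ‖Φ (X.graph.t e) - Φ (X.graph.o e)‖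

end TopologicalCrystal

/-! A crystal over `X₀` is the derived graph of a voltage assignment `α : E₀ → ℤᵈ`. Changing `α` by
a coboundary or by an automorphism of `ℤᵈ` does not change the covering, so the crystal is
determined by the kernel of the map that `α` induces from integral cycles of `X₀` to `ℤᵈ`
(`iso_of_ker`). It remains to show that condition (ii) leaves only finitely many kernels.

A normalized realization is periodic under a homomorphism `R : ℤᵈ → ℝᵈ`. If some `R n` with `n ≠ 0`
were very short, many translates of a vertex would lie close to it, whereas (ii) allows only its
neighbours and itself (`le_norm_period`). At a suitable vertex the radius in (ii) is bounded below
in terms of `X₀` and `c`, because the projected edge vectors cannot all be short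
(`exists_edge_projection_ge`). Hence all nonzero `n` satisfy `‖R n‖ ≥ ε` with `ε` independent of the
crystal.

The period of a fixed cycle is bounded independently of the crystal. By Dirichlet's pigeonhole
argument any `d + 1` cycles from a finite generating set have a nontrivial combination, with bounded
coefficients, whose period is shorter than `ε`; its voltage is then zero. These bounded relations
form a subset of a fixed finite set, and they determine the kernel by linear algebra over `ℚ`
(`eq_zero_of_common_relations`). -/

namespace DirGraph

/-! ### Integral cycles and potentials -/

/-- The endpoint difference `t(e) - o(e)`, extended linearly to all integral combinations of directed
edges. -/
noncomputable def diff {V : Type u} {E : Type v} (X : DirGraph V E) : (E →₀ ℤ) →ₗ[ℤ] (V →₀ ℤ) :=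
  Finsupp.linearCombination ℤ fun e => Finsupp.single (X.t e) 1 - Finsupp.single (X.o e) 1

/-- Integral combinations of directed edges without boundary. -/
noncomputable def cycles {V : Type u} {E : Type v} (X : DirGraph V E) : Submodule ℤ (E →₀ ℤ) :=
  LinearMap.ker X.diff

section

variable {V : Type u} {E : Type v} (X : DirGraph V E)

theorem linearCombination_diff {A : Type*} [AddCommGroup A] (F : V → A) (c : E →₀ ℤ) :
    Finsupp.linearCombination ℤ F (X.diff c) =
      Finsupp.linearCombination ℤ (fun e => F (X.t e) - F (X.o e)) c := by
  have : Finsupp.linearCombination ℤ F ∘ₗ X.diff =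
      Finsupp.linearCombination ℤ (fun e => F (X.t e) - F (X.o e)) := by
    ext e
    simp [diff]
  exact LinearMap.congr_fun this c

theorem exists_chain {x y : V} (h : Relation.ReflTransGen X.Adj x y) :
    ∃ c : E →₀ ℤ, X.diff c = Finsupp.single y 1 - Finsupp.single x 1 := by
  induction h with
  | refl => exact ⟨0, by simp⟩
  | @tail b z _ hbc ih =>
    obtain ⟨c, hc⟩ := ih
    obtain ⟨e, rfl, rfl⟩ := hbc
    refine ⟨c + Finsupp.single e 1, ?_⟩
    rw [map_add, hc]
    simp [diff]

/-- A cochain that vanishes on cycles of a connected graph is a coboundary. -/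
theorem exists_potential (hX : X.IsConnected) {A : Type*} [AddCommGroup A] (γ : E → A)
    (hγ : ∀ a ∈ X.cycles, Finsupp.linearCombination ℤ γ a = 0) :
    ∃ φ : V → A, ∀ e, γ e = φ (X.t e) - φ (X.o e) := by
  obtain ⟨⟨v⟩, hc⟩ := hX
  choose c hc using fun y => X.exists_chain (hc v y)
  refine ⟨fun y => Finsupp.linearCombination ℤ γ (c y), fun e => ?_⟩
  -- The closed chain runs from the base vertex to `o(e)`, along `e`, and back from `t(e)`.
  have := hγ (c (X.o e) + Finsupp.single e 1 - c (X.t e)) (by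
    rw [cycles, LinearMap.mem_ker, map_sub, map_add, hc, hc]
    simp [diff])
  simp only [map_add, map_sub, Finsupp.linearCombination_single, one_smul] at this
  rw [eq_sub_iff_add_eq, add_comm]
  exact sub_eq_zero.1 this

end

/-! ### Unique lifting and covering transformations -/

namespace Covering

variable {V : Type u} {E : Type v} {V₀ : Type w} {E₀ : Type w'} {X : DirGraph V E}
  {X₀ : DirGraph V₀ E₀} (ω : Covering X X₀)

theorem map_t (e : E) : X₀.t (ω.onE e) = ω.onV (X.t e) := by
  rw [t, ω.map_bar, ω.map_o, t]

theorem eq_of_onE_eq {e e' : E} (ho : X.o e = X.o e') (h : ω.onE e = ω.onE e') : e = e' :=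
  (ω.bij (X.o e)).injOn rfl ho.symm h

theorem exists_lift {x : V} {e₀ : E₀} (h : X₀.o e₀ = ω.onV x) :
    ∃ e, X.o e = x ∧ ω.onE e = e₀ :=
  (ω.bij x).surjOn h

theorem diff_mapDomain (c : E →₀ ℤ) :
    X₀.diff (c.mapDomain ω.onE) = (X.diff c).mapDomain ω.onV := by
  have : X₀.diff ∘ₗ Finsupp.lmapDomain ℤ ℤ ω.onE = Finsupp.lmapDomain ℤ ℤ ω.onV ∘ₗ X.diff := by
    refine Finsupp.lhom_ext' fun e => LinearMap.ext_ring ?_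
    simp [diff, map_t, map_o, Finsupp.mapDomain, Finsupp.sum_sub_index]
  exact LinearMap.congr_fun this c

theorem deck_o {g : Equiv.Perm V × Equiv.Perm E} (hg : g ∈ ω.deck) (e : E) :
    X.o (g.2 e) = g.1 (X.o e) := hg.1 e

theorem deck_t {g : Equiv.Perm V × Equiv.Perm E} (hg : g ∈ ω.deck) (e : E) :
    X.t (g.2 e) = g.1 (X.t e) := by
  rw [t, hg.2.1, hg.1, t]

/-- The covering transformation group of a connected graph acts freely. -/
theorem deck_eq_one (hX : X.IsConnected) {g : Equiv.Perm V × Equiv.Perm E} (hg : g ∈ ω.deck)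
    {x : V} (hx : g.1 x = x) : g = 1 := by
  have hE : ∀ e, g.1 (X.o e) = X.o e → g.2 e = e := fun e h =>
    ω.eq_of_onE_eq (by rw [hg.1, h]) (hg.2.2.2 e)
  have hV : ∀ y, g.1 y = y := fun y => by
    induction hX.2 x y with
    | refl => exact hx
    | tail _ h ih =>
      obtain ⟨e, rfl, rfl⟩ := h
      rw [← ω.deck_t hg, hE e ih]
  exact Prod.ext (Equiv.ext hV) (Equiv.ext fun e => hE e (hV _))

end Covering

end DirGraph

/-! ### Crystals as derived graphs of voltage assignments -/

namespace TopologicalCrystal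

variable {V₀ : Type u} {E₀ : Type v} {X₀ : DirGraph V₀ E₀} {d : ℕ}

/-- `X` is the derived graph of the voltage assignment `α`: its vertices are the pairs of a vertex of
`X₀` and a height in `ℤᵈ`, and the height increases by `α(e)` along an edge over `e`. -/
structure IsVoltage (X : TopologicalCrystal.{u, v, w, w'} X₀ d) (α : E₀ → Fin d → ℤ)
    (ht : X.V → Fin d → ℤ) : Prop where
  height_t : ∀ e, ht (X.graph.t e) = ht (X.graph.o e) + α (X.proj.onE e)
  inj : ∀ x y, X.proj.onV x = X.proj.onV y → ht x = ht y → x = y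
  surj : ∀ y n, ∃ x, X.proj.onV x = y ∧ ht x = n

/-- The covering transformation group acts simply transitively on each fibre, so a section `s` of
the vertex projection turns every fibre into a copy of `ℤᵈ`. The height difference along an edge is
invariant under the group, hence depends only on the projected edge. -/
theorem exists_isVoltage (X : TopologicalCrystal.{u, v, w, w'} X₀ d) :
    ∃ α ht, X.IsVoltage α ht := by
  obtain ⟨φ⟩ := X.free_abelian
  choose s hs using X.proj.surj
  have key : ∀ x, ∃ g : X.proj.deck, g.1.1 (s (X.proj.onV x)) = x := fun x => by
    obtain ⟨g, hg, h⟩ := X.regular (s (X.proj.onV x)) x (hs _)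
    exact ⟨⟨g, hg⟩, h⟩
  choose σ hσ using key
  have free : ∀ (g h : X.proj.deck) (x : X.V), g.1.1 x = h.1.1 x → g = h := fun g h x hx => by
    have : (h⁻¹ * g).1 = 1 := X.proj.deck_eq_one X.connected (h⁻¹ * g).2 (x := x) (by
      simp [hx])
    exact (inv_mul_eq_one.1 (Subtype.ext this)).symm
  have hσmul : ∀ (g : X.proj.deck) x, σ (g.1.1 x) = g * σ x := fun g x => by
    refine free _ _ (s (X.proj.onV (g.1.1 x))) ?_
    rw [hσ]
    have : X.proj.onV (g.1.1 x) = X.proj.onV x := g.2.2.2.1 x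
    rw [this]
    simp [hσ]
  have hlift : ∀ e₀, ∃ e, X.proj.onE e = e₀ := fun e₀ => by
    obtain ⟨e, -, he⟩ := X.proj.exists_lift (x := s (X₀.o e₀)) (e₀ := e₀) (hs _).symm
    exact ⟨e, he⟩
  choose l hl using hlift
  let ht : X.V → Fin d → ℤ := fun x => (φ (σ x)).toAdd
  refine ⟨fun e₀ => ht (X.graph.t (l e₀)) - ht (X.graph.o (l e₀)), ht, ?_, ?_, ?_⟩
  · intro e
    obtain ⟨g, hg, h⟩ := X.regular (X.graph.o (l (X.proj.onE e))) (X.graph.o e) (by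
      rw [← X.proj.map_o, ← X.proj.map_o, hl])
    have he : g.2 (l (X.proj.onE e)) = e := X.proj.eq_of_onE_eq
      (by rw [X.proj.deck_o hg, h]) (by rw [hg.2.2.2, hl])
    have h1 := hσmul ⟨g, hg⟩ (X.graph.o (l (X.proj.onE e)))
    have h2 := hσmul ⟨g, hg⟩ (X.graph.t (l (X.proj.onE e)))
    rw [← X.proj.deck_o hg, he] at h1
    rw [← X.proj.deck_t hg, he] at h2
    simp only [ht, h1, h2, map_mul, toAdd_mul]
    abel
  · intro x y h1 h2
    have : σ x = σ y := φ.injective (Multiplicative.toAdd.injective h2)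
    rw [← hσ x, ← hσ y, this, h1]
  · intro y n
    obtain ⟨g, hg⟩ := φ.surjective (Multiplicative.ofAdd n * (φ (σ (s y)))⁻¹)
    refine ⟨g.1.1 (s y), (g.2.2.2.1 _).trans (hs y), ?_⟩
    simp [ht, hσmul, hg]

namespace IsVoltage

variable {X : TopologicalCrystal.{u, v, w, w'} X₀ d} {α : E₀ → Fin d → ℤ}
  {ht : X.V → Fin d → ℤ}

/-- Connectedness of the crystal makes the voltage map surjective on cycles: a path between two
vertices of one fibre whose heights differ by `n` projects to such a cycle. -/
theorem exists_cycle (h : X.IsVoltage α ht) (n : Fin d → ℤ) :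
    ∃ a ∈ X₀.cycles, Finsupp.linearCombination ℤ α a = n := by
  obtain ⟨⟨x⟩, hc⟩ := X.connected
  obtain ⟨y, hy, hn⟩ := h.surj (X.proj.onV x) (ht x + n)
  obtain ⟨c, hc⟩ := X.graph.exists_chain (hc x y)
  refine ⟨c.mapDomain X.proj.onE, ?_, ?_⟩
  · rw [cycles, LinearMap.mem_ker, X.proj.diff_mapDomain, hc, ← Finsupp.lmapDomain_apply ℤ ℤ,
      map_sub]
    simp [Finsupp.mapDomain_single, hy]
  · have := X.graph.linearCombination_diff ht c
    rw [hc] at this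
    simp only [h.height_t, add_sub_cancel_left, map_sub, Finsupp.linearCombination_single, one_smul,
      hn] at this
    rw [Finsupp.linearCombination_mapDomain]
    exact this.symm

/-- Gauge equivalent voltage assignments define isomorphic crystals. -/
theorem iso {Y : TopologicalCrystal.{u, v, w, w'} X₀ d} {β : E₀ → Fin d → ℤ}
    {ht' : Y.V → Fin d → ℤ} (hX : X.IsVoltage α ht) (hY : Y.IsVoltage β ht')
    (T : (Fin d → ℤ) ≃ₗ[ℤ] (Fin d → ℤ)) (φ : V₀ → Fin d → ℤ)
    (hβ : ∀ e, β e - T (α e) = φ (X₀.t e) - φ (X₀.o e)) : X.Iso Y := by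
  -- In coordinates (vertex of `X₀`, height) the isomorphism is `(v, n) ↦ (v, T n + φ v)`; edges
  -- follow by unique lifting.
  choose f hf1 hf2 using fun x => hY.surj (X.proj.onV x) (T (ht x) + φ (X.proj.onV x))
  have hf : Bijective f := by
    refine ⟨fun x y hxy => ?_, fun y => ?_⟩
    · have h1 : X.proj.onV x = X.proj.onV y := by rw [← hf1, ← hf1, hxy]
      have h2 := hf2 x
      rw [hxy, hf2, h1, add_left_inj] at h2
      exact hX.inj x y h1 (T.injective h2.symm)
    · obtain ⟨x, h1, h2⟩ := hX.surj (Y.proj.onV y) (T.symm (ht' y - φ (Y.proj.onV y)))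
      refine ⟨x, hY.inj _ _ (by rw [hf1, h1]) ?_⟩
      rw [hf2, h2, h1]
      simp
  choose g hg1 hg2 using fun e => Y.proj.exists_lift (x := f (X.graph.o e)) (e₀ := X.proj.onE e)
    (by rw [hf1, X.proj.map_o])
  have hgt : ∀ e, Y.graph.t (g e) = f (X.graph.t e) := fun e => by
    refine hY.inj _ _ (by rw [← Y.proj.map_t, hg2, hf1, X.proj.map_t]) ?_
    rw [hY.height_t, hg1, hg2, hf2, hf2, hX.height_t, map_add, ← X.proj.map_o, ← X.proj.map_t,
      eq_add_of_sub_eq (hβ _)]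
    abel
  have hg : Bijective g := by
    refine ⟨fun e e' h => ?_, fun e' => ?_⟩
    · refine X.proj.eq_of_onE_eq (hf.1 ?_) ?_
      · rw [← hg1, ← hg1, h]
      · rw [← hg2, ← hg2, h]
    · obtain ⟨x, hx⟩ := hf.2 (Y.graph.o e')
      obtain ⟨e, he1, he2⟩ := X.proj.exists_lift (x := x) (e₀ := Y.proj.onE e')
        (by rw [Y.proj.map_o, ← hx, hf1])
      exact ⟨e, Y.proj.eq_of_onE_eq (by rw [hg1, he1, hx]) (by rw [hg2, he2])⟩
  refine ⟨Equiv.ofBijective f hf, Equiv.ofBijective g hg, hg1, fun e => ?_, hf1, hg2⟩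
  refine Y.proj.eq_of_onE_eq ?_ ?_
  · exact (hgt e).trans (hg1 _).symm
  · change Y.proj.onE (Y.graph.bar (g e)) = Y.proj.onE (g (X.graph.bar e))
    rw [← Y.proj.map_bar, hg2, hg2, X.proj.map_bar]

/-- Both voltage maps are surjections from cycles with the same kernel, so they differ by an
automorphism `T` of `ℤᵈ`. Then `β - T ∘ α` vanishes on cycles and is a coboundary, which is gauge
equivalence. -/
theorem iso_of_ker {Y : TopologicalCrystal.{u, v, w, w'} X₀ d} {β : E₀ → Fin d → ℤ}
    {ht' : Y.V → Fin d → ℤ} (hX₀ : X₀.IsConnected) (hX : X.IsVoltage α ht)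
    (hY : Y.IsVoltage β ht')
    (hker : ∀ a ∈ X₀.cycles,
      Finsupp.linearCombination ℤ α a = 0 ↔ Finsupp.linearCombination ℤ β a = 0) :
    X.Iso Y := by
  let A := Finsupp.linearCombination ℤ α ∘ₗ X₀.cycles.subtype
  let B := Finsupp.linearCombination ℤ β ∘ₗ X₀.cycles.subtype
  have hA : Surjective A := fun n => by
    obtain ⟨a, ha, h⟩ := hX.exists_cycle n
    exact ⟨⟨a, ha⟩, h⟩
  have hB : Surjective B := fun n => by
    obtain ⟨a, ha, h⟩ := hY.exists_cycle n
    exact ⟨⟨a, ha⟩, h⟩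
  have hAB : LinearMap.ker A = LinearMap.ker B := by
    ext ⟨a, ha⟩
    exact hker a ha
  let T := (A.quotKerEquivOfSurjective hA).symm ≪≫ₗ Submodule.quotEquivOfEq _ _ hAB ≪≫ₗ
    B.quotKerEquivOfSurjective hB
  have hT : ∀ a, T (A a) = B a := fun a => by
    have : (A.quotKerEquivOfSurjective hA).symm (A a) = Submodule.Quotient.mk a := by
      rw [LinearEquiv.symm_apply_eq]
      rfl
    simp only [T, LinearEquiv.trans_apply, this, Submodule.quotEquivOfEq_mk]
    rfl
  obtain ⟨φ, hφ⟩ := X₀.exists_potential hX₀ (fun e => β e - T (α e)) (fun a ha => by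
    have h1 : Finsupp.linearCombination ℤ (fun e => β e - T (α e)) =
        Finsupp.linearCombination ℤ β - T.toLinearMap ∘ₗ Finsupp.linearCombination ℤ α := by
      ext e : 2
      simp
    rw [h1]
    exact sub_eq_zero.2 (hT ⟨a, ha⟩).symm)
  exact hX.iso hY T φ hφ

end IsVoltage

end TopologicalCrystal

/-! ### Dirichlet's pigeonhole argument -/

/-- Boundedly many integral multiples of `d + 1` vectors of bounded length in `ℝᵈ` have a short
nontrivial combination. -/
theorem exists_int_combination_norm_lt (d : ℕ) (C ε : ℝ) (hε : 0 < ε) :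
    ∃ K : ℕ, ∀ w : Fin (d + 1) → EuclideanSpace ℝ (Fin d), (∀ i, ‖w i‖ ≤ C) →
      ∃ n : Fin (d + 1) → ℤ, n ≠ 0 ∧ (∀ i, n i ∈ Finset.Icc (-(K : ℤ)) K) ∧
        ‖∑ i, (n i : ℝ) • w i‖ < ε := by
  -- Cubes of side `1 / s = ε / (d + 1)`: two points in one cube are at distance at most `d / s <
  -- ε`.
  set s : ℝ := (d + 1) / ε with hs
  have hs0 : 0 < s := by positivity
  obtain ⟨A, hA⟩ := exists_nat_ge ((d + 1) * |C| * s + 1)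
  -- With coefficients in `0, …, K` there are `(K + 1) ^ (d + 1)` combinations, and at most `((2 * A
  -- + 1) * (K + 1)) ^ d` cubes. This `K` makes the latter equal to `K * (K + 1) ^ d`, which is
  -- smaller.
  refine ⟨(2 * A + 1) ^ d, fun w hw => ?_⟩
  set K : ℕ := (2 * A + 1) ^ d with hK
  have hK1 : (1 : ℝ) ≤ K := by
    rw [hK]
    exact_mod_cast Nat.one_le_pow _ _ (by omega)
  let U : (Fin (d + 1) → Fin (K + 1)) → EuclideanSpace ℝ (Fin d) :=
    fun n => ∑ i, ((n i : ℕ) : ℝ) • w i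
  have hU : ∀ n k, |U n k * s| ≤ (A - 1) * K := fun n k => by
    have h1 : |U n k| ≤ (d + 1) * (K * |C|) := by
      calc |U n k| ≤ ‖U n‖ := by simpa using PiLp.norm_apply_le (U n) k
        _ ≤ ∑ i, ‖((n i : ℕ) : ℝ) • w i‖ := norm_sum_le _ _
        _ ≤ ∑ _i : Fin (d + 1), K * |C| := by
          refine Finset.sum_le_sum fun i _ => ?_
          rw [norm_smul]
          refine mul_le_mul ?_ ((hw i).trans (le_abs_self C)) (norm_nonneg _) (by positivity)
          rw [Real.norm_natCast]
          exact_mod_cast Nat.lt_succ_iff.1 (n i).2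
        _ = (d + 1) * (K * |C|) := by simp
    rw [abs_mul, abs_of_pos hs0]
    calc |U n k| * s ≤ (d + 1) * (K * |C|) * s := by gcongr
      _ = ((d + 1) * |C| * s) * K := by ring
      _ ≤ (A - 1) * K := by
        gcongr
        linarith
  let p : (Fin (d + 1) → Fin (K + 1)) → Fin d → ℤ := fun n k => ⌊U n k * s⌋
  have hp : ∀ n ∈ (Finset.univ : Finset (Fin (d + 1) → Fin (K + 1))),
      p n ∈ Fintype.piFinset fun _ : Fin d => Finset.Icc (-((A * K : ℕ) : ℤ)) ((A * K : ℕ) : ℤ) := by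
    intro n _
    rw [Fintype.mem_piFinset]
    intro k
    have := abs_le.1 (hU n k)
    rw [Finset.mem_Icc]
    constructor
    · rw [Int.le_floor]
      push_cast
      nlinarith
    · have h2 : ((⌊U n k * s⌋ : ℤ) : ℝ) ≤ ((A * K : ℕ) : ℤ) :=
        (Int.floor_le _).trans (by push_cast; nlinarith)
      exact_mod_cast h2
  have hcard : (Fintype.piFinset fun _ : Fin d =>
      Finset.Icc (-((A * K : ℕ) : ℤ)) ((A * K : ℕ) : ℤ)).card <
      (Finset.univ : Finset (Fin (d + 1) → Fin (K + 1))).card := by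
    rw [Fintype.card_piFinset]
    simp only [Int.card_Icc, Finset.prod_const, Finset.card_univ, Fintype.card_fin,
      Fintype.card_pi]
    have h1 : (((A * K : ℕ) : ℤ) + 1 - -((A * K : ℕ) : ℤ)).toNat = 2 * (A * K) + 1 := by omega
    rw [h1]
    calc (2 * (A * K) + 1) ^ d ≤ ((2 * A + 1) * (K + 1)) ^ d :=
          Nat.pow_le_pow_left (by nlinarith) d
      _ = K * (K + 1) ^ d := by rw [mul_pow, ← hK]
      _ < (K + 1) ^ (d + 1) := by
        rw [pow_succ, mul_comm]
        exact Nat.mul_lt_mul_of_pos_left (Nat.lt_succ_self K) (by positivity)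
  obtain ⟨n, -, m, -, hnm, hpnm⟩ := Finset.exists_ne_map_eq_of_card_lt_of_maps_to hcard hp
  refine ⟨fun i => (n i : ℤ) - (m i : ℤ), fun h => hnm ?_, fun i => ?_, ?_⟩
  · ext i
    have := congrFun h i
    simp only [Pi.zero_apply] at this
    omega
  · have := (n i).2
    have := (m i).2
    simp only [Finset.mem_Icc]
    constructor <;> omega
  · have h1 : ∑ i, ((((n i : ℕ) : ℤ) - ((m i : ℕ) : ℤ) : ℤ) : ℝ) • w i = U n - U m := by
      simp only [U, ← Finset.sum_sub_distrib, ← sub_smul]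
      push_cast
      rfl
    rw [h1]
    have h2 : ∀ k, ‖(U n - U m) k‖ ≤ 1 / s := fun k => by
      have := Int.abs_sub_lt_one_of_floor_eq_floor (congrFun hpnm k)
      rw [← sub_mul, abs_mul, abs_of_pos hs0] at this
      rw [le_div_iff₀ hs0]
      exact this.le
    calc ‖U n - U m‖ = ‖∑ k, (U n - U m) k • EuclideanSpace.basisFun (Fin d) ℝ k‖ := by
          congr 1
          simpa using ((EuclideanSpace.basisFun (Fin d) ℝ).sum_repr (U n - U m)).symm
      _ ≤ ∑ k : Fin d, 1 / s := by
          refine (norm_sum_le _ _).trans (Finset.sum_le_sum fun k _ => ?_)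
          rw [norm_smul, OrthonormalBasis.norm_eq_one, mul_one]
          exact h2 k
      _ = d / s := by simp [div_eq_mul_inv]
      _ < ε := by
        rw [hs, div_div_eq_mul_div, div_lt_iff₀ (by positivity)]
        nlinarith

/-! ### Relations determine the kernel -/

/-- If the images of any `d + 1` generators under two homomorphisms into `ℤᵈ` have a common nontrivial
relation, and the first homomorphism is surjective, then its kernel lies in that of the second. -/
theorem eq_zero_of_common_relations {M : Type*} [AddCommGroup M] {d b : ℕ} (h : Fin b → M)
    (hspan : Submodule.span ℤ (Set.range h) = ⊤) (A B : M →ₗ[ℤ] (Fin d → ℤ))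
    (hA : Surjective A)
    (hrel : ∀ j : Fin (d + 1) → Fin b, ∃ n : Fin (d + 1) → ℤ, n ≠ 0 ∧
      ∑ i, n i • A (h (j i)) = 0 ∧ ∑ i, n i • B (h (j i)) = 0)
    (z : M) (hz : A z = 0) : B z = 0 := by
  let q : (Fin d → ℤ) →ₗ[ℤ] (Fin d → ℚ) :=
    { toFun := fun n k => (n k : ℚ)
      map_add' := fun a b => by ext k; simp
      map_smul' := fun a b => by ext k; simp }
  have hq : Injective q := fun a b hab => by
    ext k
    have : (a k : ℚ) = b k := congrFun hab k
    exact_mod_cast this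
  have htop : Submodule.span ℚ (Set.range fun k => q (A (h k))) = ⊤ := by
    rw [eq_top_iff]
    have h1 : ∀ m, q (A m) ∈ Submodule.span ℚ (Set.range fun k => q (A (h k))) := fun m => by
      have hm : m ∈ Submodule.span ℤ (Set.range h) := by rw [hspan]; trivial
      induction hm using Submodule.span_induction with
      | mem x hx =>
        obtain ⟨k, rfl⟩ := hx
        exact Submodule.subset_span ⟨k, rfl⟩
      | zero => simp
      | add x y _ _ hx hy => rw [map_add, map_add]; exact add_mem hx hy
      | smul a x _ hx =>
        rw [map_smul, map_smul]
        exact zsmul_mem hx a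
    rw [← (Pi.basisFun ℚ (Fin d)).span_eq, Submodule.span_le]
    rintro _ ⟨k, rfl⟩
    obtain ⟨m, hm⟩ := hA (Pi.single k 1)
    have := h1 m
    rw [hm] at this
    have hk : Pi.basisFun ℚ (Fin d) k = q (Pi.single k 1) := by
      ext l
      simp only [Pi.basisFun_apply, q, LinearMap.coe_mk, AddHom.coe_mk, Pi.single_apply]
      split_ifs <;> simp
    rw [SetLike.mem_coe, hk]
    exact this
  -- Some `d` generators have `A`-images forming a basis of `ℚᵈ`. The map `T` sends these images to
  -- the `B`-images, and the aim is `T ∘ A = B` on every generator.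
  obtain ⟨κ, a, -, hsp, hli⟩ := exists_linearIndependent' ℚ fun k => q (A (h k))
  rw [htop] at hsp
  let b₀ := Module.Basis.mk hli hsp.ge
  let b' := b₀.reindex (b₀.indexEquiv (Pi.basisFun ℚ (Fin d)))
  set a' : Fin d → Fin b := fun i => a ((b₀.indexEquiv (Pi.basisFun ℚ (Fin d))).symm i)
  have hb' : ∀ i, b' i = q (A (h (a' i))) := fun i => by simp [b', b₀, a']
  let T : (Fin d → ℚ) →ₗ[ℚ] (Fin d → ℚ) := b'.constr ℚ fun i => q (B (h (a' i)))
  have hT : ∀ i, T (q (A (h (a' i)))) = q (B (h (a' i))) := fun i => by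
    rw [← hb', Module.Basis.constr_basis]
  have hTk : ∀ k, T (q (A (h k))) = q (B (h k)) := fun k => by
    obtain ⟨n, hn0, hnA, hnB⟩ := hrel (Fin.snoc a' k)
    rw [Fin.sum_univ_castSucc] at hnA hnB
    simp only [Fin.snoc_castSucc, Fin.snoc_last] at hnA hnB
    have hA' := congrArg q hnA
    have hB' := congrArg q hnB
    simp only [map_add, map_sum, map_smul, map_zero] at hA' hB'
    -- Otherwise the relation would involve basis vectors only and be trivial. Being nonzero, the
    -- last coefficient can be cancelled, so the common relation fixes both images of generator `k`.
    have hlast : (n (Fin.last d) : ℚ) ≠ 0 := by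
      intro h0
      have h0' : n (Fin.last d) = 0 := by exact_mod_cast h0
      rw [h0', zero_smul, add_zero] at hA'
      apply hn0
      have hlin := Fintype.linearIndependent_iff.1 b'.linearIndependent
        (fun i => (n i.castSucc : ℚ)) (by
          simp only [hb', Int.cast_smul_eq_zsmul]
          exact hA')
      ext i
      refine Fin.lastCases h0' (fun i => ?_) i
      exact_mod_cast hlin i
    have h1 := congrArg T hA'
    simp only [map_add, map_sum, map_zsmul, map_zero, hT] at h1
    have h2 := h1.trans hB'.symm
    rw [add_right_inj, ← Int.cast_smul_eq_zsmul ℚ, ← Int.cast_smul_eq_zsmul ℚ] at h2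
    exact smul_right_injective _ hlast h2
  have hall : ∀ m, T (q (A m)) = q (B m) := by
    have : (T.restrictScalars ℤ ∘ₗ q) ∘ₗ A = q ∘ₗ B := by
      refine LinearMap.ext_on hspan ?_
      rintro _ ⟨k, rfl⟩
      exact hTk k
    exact fun m => LinearMap.congr_fun this m
  apply hq
  rw [← hall, hz, map_zero, map_zero]

/-! ### Lower bound for projected edges -/

namespace DirGraph

variable {V₀ : Type u} {E₀ : Type v} [Fintype E₀] (X₀ : DirGraph V₀ E₀)

/-- The antisymmetry of `x` makes `e` and its inverse contribute equally; with the scaling `1 / √2`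
of `chainVec` this gives `2 / √2 = √2`. -/
theorem inner_v₀ {x : EuclideanSpace ℝ E₀} (hx : x ∈ X₀.H₁Real) (e : E₀) :
    inner ℝ x (X₀.v₀ e) = Real.sqrt 2 * x e := by
  classical
  rw [v₀, ← Submodule.inner_starProjection_left_eq_right,
    Submodule.starProjection_eq_self_iff.2 hx]
  have hbar : x (X₀.bar e) = -x e := by
    obtain ⟨a, ha, rfl⟩ := hx
    simp only [chainVec, LinearMap.smul_apply, LinearMap.comp_apply, PiLp.smul_apply, smul_eq_mul]
    have := ha.1 e
    change (Real.sqrt 2)⁻¹ * a (X₀.bar e) = -((Real.sqrt 2)⁻¹ * a e)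
    rw [this, mul_neg]
  have hedge : chainVec (X₀.edgeChain ℝ e) = (Real.sqrt 2)⁻¹ •
      (EuclideanSpace.single e (1 : ℝ) - EuclideanSpace.single (X₀.bar e) 1) := by
    ext f
    change (Real.sqrt 2)⁻¹ * (X₀.edgeChain ℝ e) f = _
    simp [edgeChain, Finsupp.single_apply, eq_comm]
  rw [hedge, inner_smul_right, inner_sub_right, EuclideanSpace.inner_single_right,
    EuclideanSpace.inner_single_right]
  simp only [conj_trivial, one_mul, hbar]
  have h2 : (Real.sqrt 2)⁻¹ * 2 = Real.sqrt 2 := by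
    rw [inv_mul_eq_div, Real.div_sqrt]
  linear_combination x e * h2

/-- The projections of the edges to a nonzero space of harmonic chains are not all short. -/
theorem exists_edge_projection_ge (W : Submodule ℝ (EuclideanSpace ℝ E₀)) (hW : W ≤ X₀.H₁Real)
    (hne : W ≠ ⊥) :
    ∃ e, 1 ≤ (Fintype.card E₀ : ℝ) * ‖W.orthogonalProjectionOnto (X₀.v₀ e)‖ ^ 2 := by
  obtain ⟨x, hx, hx0⟩ := Submodule.exists_mem_ne_zero_of_ne_bot hne
  have hpos : 0 < ‖x‖ ^ 2 := by positivity
  have hle : ∀ e, 2 * x e ^ 2 ≤ ‖x‖ ^ 2 * ‖W.orthogonalProjectionOnto (X₀.v₀ e)‖ ^ 2 := fun e => by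
    have h1 : inner ℝ (⟨x, hx⟩ : W) (W.orthogonalProjectionOnto (X₀.v₀ e)) = Real.sqrt 2 * x e := by
      rw [Submodule.inner_orthogonalProjectionOnto_eq_of_mem_left, X₀.inner_v₀ (hW hx)]
    have h2 := abs_real_inner_le_norm (⟨x, hx⟩ : W) (W.orthogonalProjectionOnto (X₀.v₀ e))
    rw [h1] at h2
    have h3 := pow_le_pow_left₀ (abs_nonneg _) h2 2
    rw [sq_abs, mul_pow, mul_pow, Real.sq_sqrt (by norm_num)] at h3
    exact h3
  by_contra! hcon
  have hsum : ‖x‖ ^ 2 = ∑ e, x e ^ 2 := by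
    rw [EuclideanSpace.norm_sq_eq]
    simp
  have hE : Nonempty E₀ := by
    by_contra hE
    rw [not_nonempty_iff] at hE
    rw [hsum] at hpos
    simp at hpos
  have hc : (0 : ℝ) < Fintype.card E₀ := by exact_mod_cast Fintype.card_pos
  -- Summing the Cauchy–Schwarz bounds over all edges would give `2 ‖x‖ ^ 2 < ‖x‖ ^ 2` after
  -- division by the number of edges.
  have : (Fintype.card E₀ : ℝ) * ∑ e, 2 * x e ^ 2 < ∑ _e : E₀, ‖x‖ ^ 2 := by
    rw [Finset.mul_sum]
    refine Finset.sum_lt_sum_of_nonempty Finset.univ_nonempty fun e _ => ?_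
    nlinarith [mul_le_mul_of_nonneg_left (hle e) hc.le, mul_lt_mul_of_pos_left (hcon e) hpos]
  rw [← Finset.mul_sum, ← hsum, Finset.sum_const, nsmul_eq_mul, Finset.card_univ] at this
  nlinarith [mul_pos hc hpos]

end DirGraph

/-! ### Periods of realizations -/

namespace TopologicalCrystal

variable {V₀ : Type u} {E₀ : Type v} {X₀ : DirGraph V₀ E₀} {d : ℕ}
  {X : TopologicalCrystal.{u, v, w, w'} X₀ d}

/-- A realization whose edge vectors only depend on the projected edges is periodic. -/
theorem IsVoltage.exists_period {α : E₀ → Fin d → ℤ} {ht : X.V → Fin d → ℤ}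
    (h : X.IsVoltage α ht) {F : Type*} [AddCommGroup F] (Ψ : X.V → F) (U : E₀ → F)
    (hΨ : ∀ e, Ψ (X.graph.t e) - Ψ (X.graph.o e) = U (X.proj.onE e)) :
    ∃ R : (Fin d → ℤ) →+ F,
      (∀ x y, X.proj.onV x = X.proj.onV y → Ψ y - Ψ x = R (ht y - ht x)) ∧
      ∀ a ∈ X₀.cycles,
        Finsupp.linearCombination ℤ U a = R (Finsupp.linearCombination ℤ α a) := by
  choose f hf1 hf2 using fun x n => h.surj (X.proj.onV x) (ht x + n)
  obtain ⟨⟨x₀⟩, hc⟩ := X.connected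
  -- Here `f x n` is the translate of `x` by `n`. Its displacement is constant along edges, since an
  -- edge and its translate have the same edge vector.
  have hconst : ∀ n x, Ψ (f x n) - Ψ x = Ψ (f x₀ n) - Ψ x₀ := fun n x => by
    induction hc x₀ x with
    | refl => rfl
    | tail _ hab ih =>
      rw [← ih]
      obtain ⟨e, rfl, rfl⟩ := hab
      obtain ⟨e', ho, he⟩ := X.proj.exists_lift (x := f (X.graph.o e) n) (e₀ := X.proj.onE e)
        (by rw [hf1, X.proj.map_o])
      have ht' : X.graph.t e' = f (X.graph.t e) n := by
        refine h.inj _ _ (by rw [← X.proj.map_t, he, hf1, X.proj.map_t]) ?_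
        rw [h.height_t, ho, he, hf2, hf2, h.height_t]
        abel
      have h1 := hΨ e'
      rw [he, ← hΨ e, ho, ht'] at h1
      rw [sub_eq_sub_iff_add_eq_add, add_comm] at h1 ⊢
      rw [h1, add_comm]
  have hperiod : ∀ x y, X.proj.onV x = X.proj.onV y →
      Ψ y - Ψ x = Ψ (f x₀ (ht y - ht x)) - Ψ x₀ := fun x y hxy => by
    rw [← hconst _ x]
    congr 2
    exact h.inj _ _ (by rw [hf1, hxy]) (by rw [hf2]; abel)
  let R : (Fin d → ℤ) →+ F := AddMonoidHom.mk' (fun n => Ψ (f x₀ n) - Ψ x₀) fun m n => by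
    have h1 := hperiod (f x₀ m) (f x₀ (m + n)) (by rw [hf1, hf1])
    have h2 : ht (f x₀ (m + n)) - ht (f x₀ m) = n := by
      rw [hf2, hf2]
      abel
    rw [h2] at h1
    rw [← h1]
    abel
  refine ⟨R, hperiod, fun a ha => ?_⟩
  choose s hs1 hs2 using fun y => h.surj y 0
  -- With `s` the section of height zero, `U` and `R ∘ α` differ by a coboundary, so they agree on
  -- cycles.
  have hU : ∀ e, U e = R (α e) + (Ψ (s (X₀.t e)) - Ψ (s (X₀.o e))) := fun e => by
    obtain ⟨e', ho, rfl⟩ := X.proj.exists_lift (x := s (X₀.o e)) (e₀ := e) (hs1 _).symm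
    have h1 := hperiod (s (X₀.t (X.proj.onE e'))) (X.graph.t e') (by rw [hs1, X.proj.map_t])
    have h2 := h.height_t e'
    rw [ho, hs2, zero_add] at h2
    rw [h2, hs2, sub_zero] at h1
    rw [← hΨ, ho]
    change _ = (Ψ (f x₀ (α (X.proj.onE e'))) - Ψ x₀) + _
    rw [← h1]
    abel
  have hsum : Finsupp.linearCombination ℤ U = R.toIntLinearMap ∘ₗ Finsupp.linearCombination ℤ α +
      Finsupp.linearCombination ℤ fun e => Ψ (s (X₀.t e)) - Ψ (s (X₀.o e)) := by
    refine Finsupp.lhom_ext' fun e => LinearMap.ext_ring ?_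
    simp [hU]
  have hd : X₀.diff a = 0 := ha
  rw [hsum, LinearMap.add_apply, ← X₀.linearCombination_diff (fun y => Ψ (s y)) a, hd, map_zero,
    add_zero]
  rfl

variable [Fintype E₀]

theorem norm_le_maxEdge {Φ : X.V → EuclideanSpace ℝ (Fin d)} (e : X.E) :
    ‖Φ (X.graph.t e) - Φ (X.graph.o e)‖ ≤ X.maxEdge Φ (X.graph.o e) := by
  have : Finite {e' : X.E // X.graph.o e' = X.graph.o e} :=
    Finite.of_injective (fun e' => X.proj.onE e'.1) fun a b hab =>
      Subtype.ext (X.proj.eq_of_onE_eq (a.2.trans b.2.symm) hab)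
  exact le_ciSup (f := fun e' : {e' : X.E // X.graph.o e' = X.graph.o e} =>
    ‖Φ (X.graph.t e') - Φ (X.graph.o e')‖) (Set.finite_range _).bddAbove ⟨e, rfl⟩

/-- If few vertices are close to a vertex, then the periods are not short. -/
theorem IsVoltage.le_norm_period {α : E₀ → Fin d → ℤ} {ht : X.V → Fin d → ℤ}
    (h : X.IsVoltage α ht) {Ψ : X.V → EuclideanSpace ℝ (Fin d)}
    {R : (Fin d → ℤ) →+ EuclideanSpace ℝ (Fin d)}
    (hR : ∀ x y, X.proj.onV x = X.proj.onV y → Ψ y - Ψ x = R (ht y - ht x)) {x : X.V} {r : ℝ}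
    (hr : ∀ y, ‖Ψ x - Ψ y‖ ≤ r → X.graph.Adj x y ∨ y = x) {n : Fin d → ℤ} (hn : n ≠ 0) :
    r ≤ (Fintype.card E₀ + 1) * ‖R n‖ := by
  by_contra! hlt
  -- The translates of `x` by `k • n` for `0 ≤ k ≤ |E₀| + 1` are `|E₀| + 2` distinct vertices within
  -- distance `r`.
  choose f hf1 hf2 using fun k : ℕ => h.surj (X.proj.onV x) (ht x + k • n)
  have hf : Injective f := fun k l hkl => by
    have h1 := hf2 k
    rw [hkl, hf2, add_right_inj] at h1
    obtain ⟨i, hi⟩ := Function.ne_iff.1 hn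
    have h2 := congrFun h1 i
    simp only [Pi.smul_apply, nsmul_eq_mul] at h2
    exact_mod_cast (mul_right_cancel₀ hi h2).symm
  have hclose : ∀ k : Fin (Fintype.card E₀ + 2), X.graph.Adj x (f k) ∨ f k = x := fun k => by
    refine hr _ ?_
    rw [norm_sub_rev, hR x (f k) (hf1 _).symm, hf2, add_sub_cancel_left, map_nsmul,
      ← Nat.cast_smul_eq_nsmul ℝ, norm_smul, Real.norm_natCast]
    refine le_trans ?_ hlt.le
    gcongr
    exact_mod_cast Nat.lt_succ_iff.1 k.2
  -- Each admissible vertex is coded by `none` (for `x` itself) or by the projection of an edge from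
  -- `x`, which leaves only `|E₀| + 1` codes.
  have hex : ∀ k : Fin (Fintype.card E₀ + 2), ∃ o : Option E₀,
      (o = none ∧ f k = x) ∨ ∃ e, X.graph.o e = x ∧ X.graph.t e = f k ∧ o = some (X.proj.onE e) :=
    fun k => by
      rcases hclose k with ⟨e, h1, h2⟩ | h1
      · exact ⟨some (X.proj.onE e), Or.inr ⟨e, h1, h2, rfl⟩⟩
      · exact ⟨none, Or.inl ⟨rfl, h1⟩⟩
  choose o ho using hex
  have hinj : Injective o := fun k l hkl => by
    have hkl' : f k = f l := by
      rcases ho k with ⟨h1, h2⟩ | ⟨e, h1, h2, h3⟩ <;> rcases ho l with ⟨h1', h2'⟩ | ⟨e', h1', h2', h3'⟩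
      · rw [h2, h2']
      · rw [hkl, h3'] at h1
        cases h1
      · rw [hkl, h1'] at h3
        cases h3
      · rw [hkl, h3', Option.some_inj] at h3
        rw [← h2, ← h2', X.proj.eq_of_onE_eq (h1.trans h1'.symm) h3.symm]
    exact Fin.ext (hf hkl')
  have := Fintype.card_le_of_injective o hinj
  simp at this

/-- Condition (ii) is invariant under similarities. -/
theorem exists_normalized {c : ℝ} {Φ : X.V → EuclideanSpace ℝ (Fin d)} (hΦ : X.IsStandard Φ)
    (hc : ∀ x y, ‖Φ x - Φ y‖ ≤ c * X.maxEdge Φ x → X.graph.Adj x y ∨ y = x) :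
    ∃ Ψ, X.IsNormalizedStandard Ψ ∧
      ∀ x y, ‖Ψ x - Ψ y‖ ≤ c * X.maxEdge Ψ x → X.graph.Adj x y ∨ y = x := by
  obtain ⟨Ψ, hΨ, S, hS⟩ := hΦ
  refine ⟨Ψ, hΨ, fun x y hxy => hc x y ?_⟩
  have hnorm : ∀ a b, ‖Φ a - Φ b‖ = Dilation.ratio S * ‖Ψ a - Ψ b‖ := fun a b => by
    rw [hS, hS, ← dist_eq_norm, ← dist_eq_norm, Dilation.dist_eq]
  have hmax : X.maxEdge Φ x = Dilation.ratio S * X.maxEdge Ψ x := by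
    rw [maxEdge, maxEdge, Real.mul_iSup_of_nonneg (NNReal.coe_nonneg _)]
    simp only [hnorm]
  rw [hnorm, hmax, mul_left_comm]
  exact mul_le_mul_of_nonneg_left hxy (NNReal.coe_nonneg _)

variable (X₀) in
/-- The voltages of the crystals that satisfy (ii) have bounded relations among any `d + 1`
cycles. -/
theorem exists_relation_bound (hd : 1 ≤ d) {c : ℝ} (hc : 0 < c) {b : ℕ} (h : Fin b → X₀.cycles) :
    ∃ K : ℕ, ∀ (X : TopologicalCrystal.{u, v, w, w'} X₀ d) (Φ : X.V → EuclideanSpace ℝ (Fin d)),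
      X.IsStandard Φ →
      (∀ x y, ‖Φ x - Φ y‖ ≤ c * X.maxEdge Φ x → X.graph.Adj x y ∨ y = x) →
      ∀ α ht, X.IsVoltage α ht → ∀ j : Fin (d + 1) → Fin b, ∃ n : Fin (d + 1) → ℤ, n ≠ 0 ∧
        (∀ i, n i ∈ Finset.Icc (-(K : ℤ)) K) ∧
        ∑ i, n i • Finsupp.linearCombination ℤ α (h (j i)).1 = 0 := by
  set N : ℝ := (Fintype.card E₀ : ℝ) with hN
  have hN0 : 0 ≤ N := Nat.cast_nonneg _
  -- One factor `N + 1` comes from the longest edge, of length at least `1 / (N + 1)`, the other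
  -- from counting translates.
  set ε : ℝ := c / ((N + 1) * (N + 1)) with hε
  obtain ⟨K, hK⟩ := exists_int_combination_norm_lt d
    (∑ k, ∑ e, |((h k).1 e : ℝ)| * ‖X₀.v₀ e‖) ε (by positivity)
  refine ⟨K, fun X Φ hΦ hcl α ht hX j => ?_⟩
  obtain ⟨Ψ, ⟨ι, hι⟩, hcl⟩ := exists_normalized hΦ hcl
  set U : E₀ → EuclideanSpace ℝ (Fin d) :=
    fun e => ι (X.vanishingPerp.orthogonalProjectionOnto (X₀.v₀ e)) with hU
  have hUle : ∀ e, ‖U e‖ ≤ ‖X₀.v₀ e‖ := fun e => by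
    rw [hU, LinearIsometryEquiv.norm_map]
    exact Submodule.norm_orthogonalProjectionOnto_apply_le _ _
  obtain ⟨R, hR, hRa⟩ := hX.exists_period Ψ U hι
  have hne : X.vanishingPerp ≠ ⊥ := fun hbot => by
    have h1 := ι.toLinearEquiv.finrank_eq
    rw [finrank_euclideanSpace_fin, hbot, finrank_bot] at h1
    omega
  obtain ⟨e₀, he₀⟩ := X₀.exists_edge_projection_ge X.vanishingPerp inf_le_left hne
  have hδ : 1 / (N + 1) ≤ ‖U e₀‖ := by
    rw [← LinearIsometryEquiv.norm_map ι] at he₀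
    change 1 ≤ N * ‖U e₀‖ ^ 2 at he₀
    rw [div_le_iff₀ (by positivity)]
    by_contra! hlt
    have h0 := norm_nonneg (U e₀)
    nlinarith [mul_nonneg h0 hN0]
  obtain ⟨x, hx⟩ := X.proj.surj (X₀.o e₀)
  obtain ⟨e, rfl, he⟩ := X.proj.exists_lift hx.symm
  have hsep : ∀ n, n ≠ 0 → ε ≤ ‖R n‖ := fun n hn => by
    have h1 := hX.le_norm_period hR (hcl (X.graph.o e)) hn
    have h2 : 1 / (N + 1) ≤ X.maxEdge Ψ (X.graph.o e) := by
      refine hδ.trans (le_trans ?_ (norm_le_maxEdge e))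
      rw [hι, he]
    have h3 := (mul_le_mul_of_nonneg_left h2 hc.le).trans h1
    rw [hε, div_le_iff₀ (by positivity)]
    rw [mul_one_div, div_le_iff₀ (by positivity)] at h3
    linarith
  obtain ⟨n, hn0, hnK, hn⟩ := hK (fun i => Finsupp.linearCombination ℤ U (h (j i)).1) fun i => by
    refine le_trans ?_ (Finset.single_le_sum
      (f := fun k => ∑ e, |((h k).1 e : ℝ)| * ‖X₀.v₀ e‖) (fun k _ => by positivity)
      (Finset.mem_univ (j i)))
    rw [Finsupp.linearCombination_apply, Finsupp.sum_fintype _ _ fun e => zero_smul ℤ (U e)]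
    refine (norm_sum_le _ _).trans (Finset.sum_le_sum fun e _ => ?_)
    rw [← Int.cast_smul_eq_zsmul ℝ, norm_smul, Real.norm_eq_abs]
    exact mul_le_mul_of_nonneg_left (hUle e) (abs_nonneg _)
  refine ⟨n, hn0, hnK, ?_⟩
  by_contra hne0
  refine absurd (hsep _ hne0) (not_le.2 ?_)
  have hsum : R (∑ i, n i • Finsupp.linearCombination ℤ α (h (j i)).1) =
      ∑ i, (n i : ℝ) • Finsupp.linearCombination ℤ U (h (j i)).1 := by
    rw [map_sum]
    exact Finset.sum_congr rfl fun i _ => by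
      rw [map_zsmul, hRa _ (h (j i)).2, Int.cast_smul_eq_zsmul]
  rwa [hsum]

end TopologicalCrystal

/-! ### Finiteness -/

theorem theorem7p2 {V₀ : Type u} {E₀ : Type v} [Finite V₀] [Fintype E₀] (X₀ : DirGraph V₀ E₀)
    (hX₀ : X₀.IsConnected) (d : ℕ) (hd : 1 ≤ d) (c : ℝ) (hc : 0 < c) (hc1 : c ≤ 1) :
    Set.Finite (Quotient.mk (TopologicalCrystal.isoSetoid.{u, v, w, w'} X₀ d) ''
      {X | ∃ Φ : X.V → EuclideanSpace ℝ (Fin d), X.IsStandard Φ ∧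
        Function.Injective Φ ∧
        ∀ x y, ‖Φ x - Φ y‖ ≤ c * X.maxEdge Φ x → X.graph.Adj x y ∨ y = x}) := by
  obtain ⟨b, h, hspan⟩ := Module.Finite.exists_fin (R := ℤ) (M := X₀.cycles)
  obtain ⟨K, hK⟩ := TopologicalCrystal.exists_relation_bound X₀ hd hc h
  choose α ht hα using fun X : TopologicalCrystal.{u, v, w, w'} X₀ d => X.exists_isVoltage
  -- The finite invariant: all relations with coefficients in `[-K, K]` among the voltages of `d +
  -- 1` generating cycles. Equal invariants give equal kernels, hence isomorphic crystals.
  let rel : TopologicalCrystal.{u, v, w, w'} X₀ d →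
      Set ((Fin (d + 1) → Fin b) × (Fin (d + 1) → Finset.Icc (-(K : ℤ)) K)) := fun X =>
    {p | ∑ i, (p.2 i : ℤ) • Finsupp.linearCombination ℤ (α X) (h (p.1 i)).1 = 0}
  have hker : ∀ X Y : TopologicalCrystal.{u, v, w, w'} X₀ d, rel X = rel Y →
      (∃ Φ : X.V → EuclideanSpace ℝ (Fin d), X.IsStandard Φ ∧ Function.Injective Φ ∧
        ∀ x y, ‖Φ x - Φ y‖ ≤ c * X.maxEdge Φ x → X.graph.Adj x y ∨ y = x) →
      ∀ a ∈ X₀.cycles, Finsupp.linearCombination ℤ (α X) a = 0 →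
        Finsupp.linearCombination ℤ (α Y) a = 0 := by
    rintro X Y hXY ⟨Φ, hΦ, -, hcl⟩ a ha haX
    refine eq_zero_of_common_relations h hspan
      (Finsupp.linearCombination ℤ (α X) ∘ₗ X₀.cycles.subtype)
      (Finsupp.linearCombination ℤ (α Y) ∘ₗ X₀.cycles.subtype) (fun n => ?_) (fun j => ?_)
      ⟨a, ha⟩ haX
    · obtain ⟨a, ha, h⟩ := (hα X).exists_cycle n
      exact ⟨⟨a, ha⟩, h⟩
    · obtain ⟨n, hn0, hnK, hn⟩ := hK X Φ hΦ hcl (α X) (ht X) (hα X) j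
      have hmem : (j, fun i => ⟨n i, hnK i⟩) ∈ rel X := hn
      rw [hXY] at hmem
      exact ⟨n, hn0, hn, hmem⟩
  have hrep : ∀ q : (Quotient.mk (TopologicalCrystal.isoSetoid.{u, v, w, w'} X₀ d) ''
      {X | ∃ Φ : X.V → EuclideanSpace ℝ (Fin d), X.IsStandard Φ ∧ Function.Injective Φ ∧
        ∀ x y, ‖Φ x - Φ y‖ ≤ c * X.maxEdge Φ x → X.graph.Adj x y ∨ y = x}),
      ∃ X : TopologicalCrystal.{u, v, w, w'} X₀ d,
        (∃ Φ : X.V → EuclideanSpace ℝ (Fin d), X.IsStandard Φ ∧ Function.Injective Φ ∧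
          ∀ x y, ‖Φ x - Φ y‖ ≤ c * X.maxEdge Φ x → X.graph.Adj x y ∨ y = x) ∧
        Quotient.mk _ X = q.1 := fun q => q.2
  choose rep hrep using hrep
  refine Set.finite_coe_iff.1 (Finite.of_injective (fun q => rel (rep q)) fun q q' hqq =>
    Subtype.ext ?_)
  rw [← (hrep q).2, ← (hrep q').2]
  exact Quotient.sound ((hα _).iso_of_ker hX₀ (hα _) fun a ha =>
    ⟨hker _ _ hqq (hrep q).1 a ha, hker _ _ hqq.symm (hrep q').1 a ha⟩)
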